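/- Let $n\ge 2$, let $M\in\mathbb{R}^{n\times n}$ be an irreducible (entrywise) nonnegative matrix, let $N=\{1,\dots,n\}$, and let $\rho(\cdot)$ denote the spectral radius, i.e. the largest absolute value of a complex eigenvalue. For a nonempty $S\subseteq N$ with complement $\bar S$, the isoradial reduction of $M$ over $S$ is $$\mathcal{I}_S(M)=M_{SS}-M_{S\bar S}\,\bigl(M_{\bar S\bar S}-\rho(M)I\bigr)^{-1}M_{\bar S S},$$ with rows and columns indexed by $S$ (and $\mathcal{I}_N(M)=M$); it exists if the inverse does. The effective transition matrix $\mathcal{E}(M)=[\varepsilon_{ij}]\in\mathbb{R}^{n\times n}$ is given by $$\varepsilon_{ij}=\bigl(\mathcal{I}_{\{i,j\}}(M)\bigr)_{ij}\ \text{ for } i\ne j,\qquad \varepsilon_{ii}=\sum_{k\ne i}\bigl(\mathcal{I}_{\{i,k\}}(M)\bigr)_{ii}.$$ The leading eigenvector of an irreducible nonnegative matrix $A\in\mathbb{R}^{n\times n}$ is the unique vector $v$ with positive entries such that $Av=\rho(A)v$ and $\sum_i v_i=1$. Then all the isoradial reductions $\mathcal{I}_{\{i,j\}}(M)$, $i\neq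 j$, exist, and: (i) $\mathcal{E}(M)$ is nonnegative and irreducible; (ii) $M$ and $\mathcal{E}(M)$ have the same leading eigenvector; (iii) $\rho(\mathcal{E}(M))=(n-1)\,\rho(M)$. (iv) If moreover $M$ is row stochastic, then $\mathcal{S}(M)=\frac{1}{n-1}\mathcal{E}(M)$ is row stochastic, and the Markov chains associated with $M$ and $\mathcal{S}(M)$ have the same unique stationary distribution, that is, there is one nonnegative row vector $\pi$ with $\sum_i\pi_i=1$ that is the only solution $q\in\mathbb{R}^n$ of $qM=q$, $\sum_i q_i=1$, and also the only solution of $q\,\mathcal{S}(M)=q$, $\sum_i q_i=1$. If in addition $n\ge 3$, or $n=2$ and $M$ is itself primitive, then $\mathcal{S}(M)$ is primitive, i.e. some positive power of it is entrywise positive. -/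

import Mathlib

noncomputable section

namespace EffTrans

open Matrix

variable {ι : Type*} [Fintype ι] [DecidableEq ι]

/-- The spectral radius `ρ(M) = max {|λ| : λ a complex eigenvalue of M}` of a real square matrix,
as a real number. -/
def specRadius (M : Matrix ι ι ℝ) : ℝ :=
  (spectralRadius ℂ (M.map (algebraMap ℝ ℂ))).toReal

/-- The matrix `M_{S̄S̄} - ρ(M) I`, where `S̄` is the complement of `S`. -/
def shiftedBlock (M : Matrix ι ι ℝ) (S : Finset ι) :
    Matrix {a // a ∉ S} {a // a ∉ S} ℝ :=
  M.toBlock (· ∉ S) (· ∉ S) - specRadius M • (1 : Matrix {a // a ∉ S} {a // a ∉ S} ℝ)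

/-- The isoradial reduction of `M` over `S` exists: `M_{S̄S̄} - ρ(M) I` is invertible. -/
def IsoradialExists (M : Matrix ι ι ℝ) (S : Finset ι) : Prop :=
  IsUnit (shiftedBlock M S)

/-- The isoradial reduction
`I_S(M) = M_{SS} - M_{SS̄} (M_{S̄S̄} - ρ(M) I)⁻¹ M_{S̄S}`; rows and columns are indexed by the
elements of `S` themselves. It is meaningful when `IsoradialExists M S` holds. -/
def isoradialReduction (M : Matrix ι ι ℝ) (S : Finset ι) :
    Matrix {a // a ∈ S} {a // a ∈ S} ℝ :=
  M.toBlock (· ∈ S) (· ∈ S)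
    - M.toBlock (· ∈ S) (· ∉ S) * (shiftedBlock M S)⁻¹ * M.toBlock (· ∉ S) (· ∈ S)

/-- The effective transition matrix `E(M)`. For `i ≠ j` its entry is the entry of
`I_{{i,j}}(M)` in the row belonging to `i` and the column belonging to `j`; its `i`-th diagonal entry is the sum
over `k ≠ i` of the diagonal entries of `I_{{i,k}}(M)` belonging to `i`. -/
def effectiveTransition (M : Matrix ι ι ℝ) : Matrix ι ι ℝ :=
  Matrix.of fun i j =>
    if i = j then
      ∑ k ∈ Finset.univ.erase i,
        isoradialReduction M {i, k} ⟨i, by simp⟩ ⟨i, by simp⟩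
    else
      isoradialReduction M {i, j} ⟨i, by simp⟩ ⟨j, by simp⟩

/-- The scaled effective transition matrix `S(M) = E(M) / (n - 1)`. -/
def scaledEffectiveTransition {n : ℕ} (M : Matrix (Fin n) (Fin n) ℝ) :
    Matrix (Fin n) (Fin n) ℝ :=
  ((n : ℝ) - 1)⁻¹ • effectiveTransition M

/-- `v` is a positive eigenvector of `M` for the eigenvalue `ρ(M)`, normalized so that its entries
sum to one. -/
def IsLeadingEigenvector (M : Matrix ι ι ℝ) (v : ι → ℝ) : Prop :=
  (∀ i, 0 < v i) ∧ M *ᵥ v = specRadius M • v ∧ ∑ i, v i = 1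

/-- `p` satisfies `p P = p` and its entries sum to one. (No sign condition is imposed, so that
uniqueness is asserted among all real vectors.) -/
def IsStationary (P : Matrix ι ι ℝ) (p : ι → ℝ) : Prop :=
  p ᵥ* P = p ∧ ∑ i, p i = 1

end EffTrans

end

namespace EffTrans

open Matrix

/-! ### Perron–Frobenius theory for irreducible matrices. -/

section PerronFrobenius

variable {ι : Type*} [Fintype ι] {A : Matrix ι ι ℝ}

/-! The reduction over `S` is a Schur complement: if `M u = ρ(M) u` holds off `S`, it sends the
restriction of `u` to that of `M u` (`isoradialReduction_mulVec_apply`). So every pair reduction has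
the restricted Perron vector `v` as eigenvector for `ρ(M)`, and since row `i` of `E(M)` collects the
`n - 1` pairs containing `i`, `E(M) v = (n - 1) ρ(M) v`. A positive eigenvector of a nonnegative
matrix determines the spectral radius, and irreducibility makes it unique up to scale.

Signs come from the minimum principle `nonneg_of_mulVec_eq_off`: it makes the shifted blocks
injective and the reductions nonnegative. Off-diagonal entries of `E(M)` are even positive, which
yields irreducibility, and primitivity for `n ≥ 3`. Stationary vectors are left eigenvectors,
reached by transposing. -/

/-- The zero set of a nonnegative vector `w` cannot be both nonempty and proper if `A w` vanishes
on it. -/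
theorem _root_.Matrix.IsIrreducible.pos_of_mulVec_nonpos (hA : A.IsIrreducible) {w : ι → ℝ}
    (hw : ∀ i, 0 ≤ w i) {s : ι} (hs : 0 < w s) (h : ∀ a, w a = 0 → (A *ᵥ w) a ≤ 0) (i : ι) :
    0 < w i := by
  classical
  by_contra hi
  have hclosed : ∀ a b, w a = 0 → w b ≠ 0 → A a b = 0 := by
    intro a b ha hb
    have h0 : ∑ c, A a c * w c = 0 :=
      le_antisymm (h a ha) (Finset.sum_nonneg fun c _ => mul_nonneg (hA.nonneg a c) (hw c))
    rw [Finset.sum_eq_zero_iff_of_nonneg fun c _ => mul_nonneg (hA.nonneg a c) (hw c)] at h0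
    exact (mul_eq_zero.mp (h0 b (Finset.mem_univ b))).resolve_right hb
  have hpow : ∀ k a b, w a = 0 → w b ≠ 0 → (A ^ k) a b = 0 := by
    intro k
    induction k with
    | zero =>
      intro a b ha hb
      rw [pow_zero, one_apply_ne]
      rintro rfl
      exact hb ha
    | succ k ih =>
      intro a b ha hb
      rw [pow_succ, mul_apply]
      refine Finset.sum_eq_zero fun c _ => ?_
      by_cases hc : w c = 0
      · rw [hclosed c b hc hb, mul_zero]
      · rw [ih a c ha hc, zero_mul]
  obtain ⟨k, -, hk⟩ := (isIrreducible_iff_exists_pow_pos hA.nonneg).mp hA i s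
  exact hk.ne' (hpow k i s (le_antisymm (not_lt.mp hi) (hw i)) hs.ne')

/-- A real eigenvector for the eigenvalue of a positive eigenvector is a multiple of the latter. -/
theorem _root_.Matrix.IsIrreducible.eq_smul_of_mulVec_eq [Nonempty ι] (hA : A.IsIrreducible)
    {r : ℝ} {v x : ι → ℝ} (hv : ∀ i, 0 < v i) (hAv : A *ᵥ v = r • v) (hAx : A *ᵥ x = r • x) :
    ∃ c : ℝ, x = c • v := by
  -- Subtracting the minimal ratio times `v` leaves a nonnegative eigenvector with a zero at `m`, so
  -- it must vanish.
  obtain ⟨m, hm⟩ := Finite.exists_min fun i => x i / v i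
  refine ⟨x m / v m, ?_⟩
  have hw : ∀ i, 0 ≤ (x - (x m / v m) • v) i := fun i => by
    have := (le_div_iff₀ (hv i)).mp (hm i)
    simpa using this
  have hwm : (x - (x m / v m) • v) m = 0 := by
    simp [div_mul_cancel₀ _ (hv m).ne']
  have hAw : A *ᵥ (x - (x m / v m) • v) = r • (x - (x m / v m) • v) := by
    rw [mulVec_sub, mulVec_smul, hAv, hAx, smul_sub, smul_comm]
  by_contra hne
  obtain ⟨s, hs⟩ : ∃ s, (x - (x m / v m) • v) s ≠ 0 := by
    by_contra! h0
    exact hne (sub_eq_zero.mp (funext h0))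
  refine (hA.pos_of_mulVec_nonpos hw (lt_of_le_of_ne (hw s) hs.symm) (fun a ha => ?_) m).ne' hwm
  rw [hAw, Pi.smul_apply, ha, smul_zero]

theorem mulVec_pos {B : Matrix ι ι ℝ} (hB : ∀ i j, 0 < B i j) {x : ι → ℝ} (hx : 0 ≤ x)
    (hx0 : x ≠ 0) (i : ι) : 0 < (B *ᵥ x) i := by
  obtain ⟨j, hj⟩ := Function.ne_iff.mp hx0
  exact Finset.sum_pos' (fun j _ => mul_nonneg (hB i j).le (hx j))
    ⟨j, Finset.mem_univ j, mul_pos (hB i j) (lt_of_le_of_ne (hx j) (Ne.symm hj))⟩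

variable [DecidableEq ι]

/-- An irreducible matrix commutes with some entrywise positive matrix. -/
theorem _root_.Matrix.IsIrreducible.exists_pos_commute (hA : A.IsIrreducible) :
    ∃ B : Matrix ι ι ℝ, (∀ i j, 0 < B i j) ∧ Commute A B := by
  choose k _ hk using (isIrreducible_iff_exists_pow_pos hA.nonneg).mp hA
  refine ⟨∑ p : ι × ι, A ^ k p.1 p.2, fun i j => ?_,
    Commute.sum_right _ _ _ fun p _ => (Commute.refl A).pow_right _⟩
  rw [Matrix.sum_apply]
  exact Finset.sum_pos' (fun p _ => pow_apply_nonneg hA.nonneg _ i j)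
    ⟨(i, j), Finset.mem_univ _, hk i j⟩

/-- Perron's theorem: existence of a positive eigenvector, by maximizing the Collatz-Wielandt
quotient over the simplex. -/
theorem _root_.Matrix.IsIrreducible.exists_pos_eigenvector [Nonempty ι] (hA : A.IsIrreducible) :
    ∃ (r : ℝ) (v : ι → ℝ), (∀ i, 0 < v i) ∧ A *ᵥ v = r • v := by
  obtain ⟨B, hB, hAB⟩ := hA.exists_pos_commute
  -- The upper bound on the quotient only secures compactness; `hbound` shows that it excludes
  -- nothing.
  let K : Set (ℝ × (ι → ℝ)) :=
    (Set.Icc 0 (∑ i, ∑ j, A i j) ×ˢ stdSimplex ℝ ι) ∩ {p | p.1 • p.2 ≤ A *ᵥ p.2}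
  have hK : IsCompact K := by
    refine (isCompact_Icc.prod (isCompact_stdSimplex ℝ ι)).inter_right (isClosed_le ?_ ?_)
    · fun_prop
    · exact continuous_const.matrix_mulVec continuous_snd
  have hbound : ∀ t x, x ∈ stdSimplex ℝ ι → t • x ≤ A *ᵥ x → t ≤ ∑ i, ∑ j, A i j := by
    intro t x hx htx
    calc t = ∑ i, t * x i := by rw [← Finset.mul_sum, hx.2, mul_one]
      _ ≤ ∑ i, ∑ j, A i j * x j := Finset.sum_le_sum fun i _ => htx i
      _ ≤ ∑ i, ∑ j, A i j := by
        refine Finset.sum_le_sum fun i _ => Finset.sum_le_sum fun j _ => ?_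
        refine mul_le_of_le_one_right (hA.nonneg i j) ?_
        rw [← hx.2]
        exact Finset.single_le_sum (fun k _ => hx.1 k) (Finset.mem_univ j)
  obtain ⟨i₀⟩ := ‹Nonempty ι›
  have hne : K.Nonempty := by
    refine ⟨(0, Pi.single i₀ 1), ⟨⟨le_rfl, ?_⟩, single_mem_stdSimplex ℝ i₀⟩, ?_⟩
    · exact Finset.sum_nonneg fun i _ => Finset.sum_nonneg fun j _ => hA.nonneg i j
    · intro i
      simpa using hA.nonneg i i₀
  obtain ⟨⟨r, x⟩, ⟨⟨⟨hr0, -⟩, hx⟩, hrx⟩, hmax⟩ := hK.exists_isMaxOn hne continuous_fst.continuousOn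
  simp only at hr0 hx hrx
  have hx0 : x ≠ 0 := by
    rintro rfl
    simpa using hx.2
  have hy : ∀ i, 0 < (B *ᵥ x) i := mulVec_pos hB hx.1 hx0
  have hcomm : A *ᵥ (B *ᵥ x) - r • (B *ᵥ x) = B *ᵥ (A *ᵥ x - r • x) := by
    rw [mulVec_sub, mulVec_smul, mulVec_mulVec, mulVec_mulVec, hAB.eq]
  refine ⟨r, B *ᵥ x, hy, ?_⟩
  by_contra hney
  have hd0 : A *ᵥ x - r • x ≠ 0 := by
    intro h0
    rw [h0, mulVec_zero, sub_eq_zero] at hcomm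
    exact hney hcomm
  -- Applying `B` makes a nonzero defect strictly positive, so the normalized `B x` admits a
  -- quotient `r + δ > r`, against maximality.
  have hgap : ∀ i, 0 < (A *ᵥ (B *ᵥ x) - r • (B *ᵥ x)) i := by
    rw [hcomm]
    exact mulVec_pos hB (sub_nonneg.mpr hrx) hd0
  generalize B *ᵥ x = y at hy hgap
  obtain ⟨m, hm⟩ := Finite.exists_min fun i => (A *ᵥ y - r • y) i / y i
  have hδ : 0 < (A *ᵥ y - r • y) m / y m := div_pos (hgap m) (hy m)
  set δ := (A *ᵥ y - r • y) m / y m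
  have hsum : 0 < ∑ i, y i := Finset.sum_pos (fun i _ => hy i) ⟨i₀, Finset.mem_univ _⟩
  have hz : (∑ i, y i)⁻¹ • y ∈ stdSimplex ℝ ι := by
    refine ⟨fun i => mul_nonneg (inv_nonneg.mpr hsum.le) (hy i).le, ?_⟩
    simp only [Pi.smul_apply, smul_eq_mul, ← Finset.mul_sum]
    exact inv_mul_cancel₀ hsum.ne'
  have hle : (r + δ) • ((∑ i, y i)⁻¹ • y) ≤ A *ᵥ ((∑ i, y i)⁻¹ • y) := by
    rw [mulVec_smul, smul_comm]
    refine smul_le_smul_of_nonneg_left (fun i => ?_) (inv_nonneg.mpr hsum.le)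
    have := (le_div_iff₀ (hy i)).mp (hm i)
    simp only [Pi.sub_apply, Pi.smul_apply, smul_eq_mul] at this ⊢
    linarith
  have := hmax (show (r + δ, (∑ i, y i)⁻¹ • y) ∈ K from
    ⟨⟨⟨by positivity, hbound _ _ hz hle⟩, hz⟩, hle⟩)
  simp only [Set.mem_ofPred_eq] at this
  linarith

/-- A nonnegative matrix with a positive eigenvector has the eigenvalue of that eigenvector as its
spectral radius. -/
theorem specRadius_eq_of_mulVec_eq [Nonempty ι] (hA : ∀ i j, 0 ≤ A i j) {r : ℝ} {v : ι → ℝ}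
    (hv : ∀ i, 0 < v i) (hAv : A *ᵥ v = r • v) : specRadius A = r := by
  have hrow : ∀ i, ∑ j, A i j * v j = r * v i := fun i => congrFun hAv i
  obtain ⟨i₀⟩ := ‹Nonempty ι›
  have hr : 0 ≤ r := by
    refine nonneg_of_mul_nonneg_left ?_ (hv i₀)
    rw [← hrow]
    exact Finset.sum_nonneg fun j _ => mul_nonneg (hA i₀ j) (hv j).le
  have hspec : ∀ z : ℂ, z ∈ spectrum ℂ (A.map (algebraMap ℝ ℂ)) ↔
      ∃ x : ι → ℂ, x ≠ 0 ∧ A.map (algebraMap ℝ ℂ) *ᵥ x = z • x := by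
    intro z
    rw [← spectrum_toLin', ← Module.End.hasEigenvalue_iff_mem_spectrum]
    constructor
    · intro h
      obtain ⟨x, hx⟩ := h.exists_hasEigenvector
      exact ⟨x, hx.2, by simpa using hx.apply_eq_smul⟩
    · rintro ⟨x, hx0, hx⟩
      exact Module.End.hasEigenvalue_of_hasEigenvector
        (Module.End.hasEigenvector_iff.mpr ⟨Module.End.mem_eigenspace_iff.mpr (by simpa using hx), hx0⟩)
  have hmem : (r : ℂ) ∈ spectrum ℂ (A.map (algebraMap ℝ ℂ)) := by
    refine (hspec _).mpr ⟨fun i => (v i : ℂ), fun h => ?_, funext fun i => ?_⟩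
    · exact (hv i₀).ne' (by simpa using congrFun h i₀)
    · simpa [mulVec, dotProduct] using congrArg (Complex.ofReal) (hrow i)
  have hle : ∀ z ∈ spectrum ℂ (A.map (algebraMap ℝ ℂ)), ‖z‖ ≤ r := by
    intro z hz
    obtain ⟨x, hx0, hx⟩ := (hspec z).mp hz
    have : Nonempty ι := ⟨i₀⟩
    -- At the maximal ratio, row `m` of the eigenvector equation gives `‖z‖ ≤ r` by the triangle
    -- inequality.
    obtain ⟨m, hm⟩ := Finite.exists_max fun i => ‖x i‖ / v i
    obtain ⟨j, hj⟩ := Function.ne_iff.mp hx0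
    have hc : 0 < ‖x m‖ / v m := (div_pos (norm_pos_iff.mpr hj) (hv j)).trans_le (hm j)
    set c := ‖x m‖ / v m with hcdef
    have hxm : ‖x m‖ = c * v m := (div_mul_cancel₀ _ (hv m).ne').symm
    have key : ‖z‖ * (c * v m) ≤ r * (c * v m) := by
      calc ‖z‖ * (c * v m) = ‖∑ j, (A m j : ℂ) * x j‖ := by
            rw [← hxm, ← norm_mul]
            exact congrArg norm (congrFun hx m).symm
        _ ≤ ∑ j, ‖(A m j : ℂ) * x j‖ := norm_sum_le _ _
        _ ≤ ∑ j, A m j * (c * v j) := by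
            refine Finset.sum_le_sum fun j _ => ?_
            rw [norm_mul, Complex.norm_of_nonneg (hA m j)]
            exact mul_le_mul_of_nonneg_left ((div_le_iff₀ (hv j)).mp (hm j)) (hA m j)
        _ = c * ∑ j, A m j * v j := by
            rw [Finset.mul_sum]
            exact Finset.sum_congr rfl fun j _ => by ring
        _ = r * (c * v m) := by rw [hrow]; ring
    exact le_of_mul_le_mul_right key (mul_pos hc (hv m))
  have hrad : spectralRadius ℂ (A.map (algebraMap ℝ ℂ)) = ENNReal.ofReal r := by
    refine le_antisymm (iSup₂_le fun z hz => ?_) ?_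
    · rw [← enorm_eq_nnnorm, ← ofReal_norm]
      exact ENNReal.ofReal_le_ofReal (hle z hz)
    · refine le_trans (le_of_eq ?_) (le_iSup₂ (α := ENNReal) (r : ℂ) hmem)
      rw [← enorm_eq_nnnorm, ← ofReal_norm, Complex.norm_of_nonneg hr]
  rw [specRadius, hrad, ENNReal.toReal_ofReal hr]

theorem isLeadingEigenvector_iff_eq [Nonempty ι] (hA : A.IsIrreducible) {v : ι → ℝ}
    (hv : IsLeadingEigenvector A v) (w : ι → ℝ) : IsLeadingEigenvector A w ↔ w = v := by
  refine ⟨fun hw => ?_, fun h => h ▸ hv⟩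
  obtain ⟨c, rfl⟩ := hA.eq_smul_of_mulVec_eq hv.1 hv.2.1 hw.2.1
  have : c = 1 := by simpa [← Finset.mul_sum, hv.2.2] using hw.2.2
  rw [this, one_smul]

theorem exists_isLeadingEigenvector [Nonempty ι] (hA : A.IsIrreducible) :
    ∃ v, IsLeadingEigenvector A v := by
  obtain ⟨r, v, hv, hAv⟩ := hA.exists_pos_eigenvector
  have hsum : 0 < ∑ i, v i := Finset.sum_pos (fun i _ => hv i) Finset.univ_nonempty
  refine ⟨(∑ i, v i)⁻¹ • v, fun i => mul_pos (inv_pos.mpr hsum) (hv i), ?_, ?_⟩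
  · rw [specRadius_eq_of_mulVec_eq hA.nonneg hv hAv, mulVec_smul, hAv, smul_comm]
  · simp only [Pi.smul_apply, smul_eq_mul, ← Finset.mul_sum]
    exact inv_mul_cancel₀ hsum.ne'

end PerronFrobenius

/-! ### Isoradial reductions and the effective transition matrix. -/

section Reduction

variable {ι : Type*} [Fintype ι] {M : Matrix ι ι ℝ}

/-- Minimum principle: a vector that is nonnegative on a nonempty set `S` and satisfies the
eigenvector equation for the Perron eigenvalue off `S` is nonnegative. -/
theorem nonneg_of_mulVec_eq_off (hM : M.IsIrreducible) {r : ℝ} {v : ι → ℝ} (hv : ∀ i, 0 < v i)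
    (hMv : M *ᵥ v = r • v) {S : Finset ι} (hS : S.Nonempty) {u : ι → ℝ} (hu : ∀ a ∈ S, 0 ≤ u a)
    (h : ∀ a ∉ S, (M *ᵥ u) a = r * u a) (a : ι) : 0 ≤ u a := by
  obtain ⟨s, hs⟩ := hS
  have : Nonempty ι := ⟨s⟩
  obtain ⟨m, hm⟩ := Finite.exists_min fun i => u i / v i
  by_contra! ha
  have hc : u m / v m < 0 := (hm a).trans_lt (div_neg_of_neg_of_pos ha (hv a))
  set c := u m / v m with hcdef
  -- Since `c < 0`, all zeros of `u - c v` lie off `S`, where the eigenvector equation holds; yet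
  -- `m` is such a zero.
  have hpos : ∀ b ∈ S, 0 < (u - c • v) b := fun b hb => by
    have h1 := hu b hb
    have h2 := mul_neg_of_neg_of_pos hc (hv b)
    simp only [Pi.sub_apply, Pi.smul_apply, smul_eq_mul]
    linarith
  have hnonneg : ∀ b, 0 ≤ (u - c • v) b := fun b => by
    simpa using (le_div_iff₀ (hv b)).mp (hm b)
  refine (hM.pos_of_mulVec_nonpos hnonneg (hpos s hs) (fun b hb => ?_) m).ne' ?_
  · have hbS : b ∉ S := fun hbS => (hpos b hbS).ne' hb
    rw [mulVec_sub, mulVec_smul, hMv, Pi.sub_apply, h b hbS]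
    have : r * (u - c • v) b = 0 := by rw [hb, mul_zero]
    simp only [Pi.sub_apply, Pi.smul_apply, smul_eq_mul] at this ⊢
    linarith
  · simp [hcdef, div_mul_cancel₀ _ (hv m).ne']

theorem mul_apply_pos_of_mid {A : Matrix ι ι ℝ} (hA : ∀ i j, 0 ≤ A i j) {i j k : ι}
    (hik : 0 < A i k) (hkj : 0 < A k j) : 0 < (A * A) i j :=
  Finset.sum_pos' (fun l _ => mul_nonneg (hA i l) (hA l j))
    ⟨k, Finset.mem_univ k, mul_pos hik hkj⟩

/-- An irreducible matrix with positive left eigenvector `p` for the eigenvalue `1` has `p` as its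
only stationary vector. -/
theorem isStationary_iff_eq [Nonempty ι] {P : Matrix ι ι ℝ} (hP : P.IsIrreducible) {p : ι → ℝ}
    (hp : ∀ i, 0 < p i) (hst : IsStationary P p) (q : ι → ℝ) : IsStationary P q ↔ q = p := by
  refine ⟨fun hq => ?_, fun h => h ▸ hst⟩
  obtain ⟨c, rfl⟩ := hP.transpose.eq_smul_of_mulVec_eq (r := 1) hp
    (by rw [mulVec_transpose, hst.1, one_smul]) (by rw [mulVec_transpose, hq.1, one_smul])
  have : c = 1 := by simpa [← Finset.mul_sum, hst.2] using hq.2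
  rw [this, one_smul]

variable [DecidableEq ι]

theorem mulVec_apply_eq_add (M : Matrix ι ι ℝ) (S : Finset ι) (u : ι → ℝ) (a : ι) :
    (M *ᵥ u) a = (∑ b : {b // b ∈ S}, M a b * u b) + ∑ b : {b // b ∉ S}, M a b * u b := by
  change ∑ b, M a b * u b = _
  convert (Fintype.sum_subtype_add_sum_subtype (· ∈ S) fun b => M a b * u b).symm

theorem shiftedBlock_mulVec_apply (S : Finset ι) (u : ι → ℝ) (a : {a // a ∉ S}) :
    (shiftedBlock M S *ᵥ fun b => u b) a
      = (M *ᵥ u) a - (M.toBlock (· ∉ S) (· ∈ S) *ᵥ fun b => u b) a - specRadius M * u a := by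
  rw [shiftedBlock, sub_mulVec, smul_mulVec, one_mulVec, mulVec_apply_eq_add M S]
  simp [mulVec, dotProduct, toBlock_apply]

/-- A kernel vector of the shifted block, extended by zero, satisfies the equation off `S`. The
minimum principle applies to it and to its negative, so it is zero. -/
theorem isoradialExists (hM : M.IsIrreducible) {v : ι → ℝ} (hv : ∀ i, 0 < v i)
    (hMv : M *ᵥ v = specRadius M • v) {S : Finset ι} (hS : S.Nonempty) : IsoradialExists M S := by
  have key : ∀ z : {a // a ∉ S} → ℝ, shiftedBlock M S *ᵥ z = 0 → ∀ a, 0 ≤ z a := by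
    intro z hz a
    set u : ι → ℝ := fun a => if h : a ∈ S then 0 else z ⟨a, h⟩ with hu
    have huz : (fun b : {b // b ∉ S} => u b) = z := funext fun b => dif_neg b.2
    have huS : ∀ b ∈ S, u b = 0 := fun b hb => dif_pos hb
    have hoff : ∀ b ∉ S, (M *ᵥ u) b = specRadius M * u b := by
      intro b hb
      have h1 := shiftedBlock_mulVec_apply (M := M) S u ⟨b, hb⟩
      rw [huz, hz] at h1
      have h2 : (M.toBlock (· ∉ S) (· ∈ S) *ᵥ fun b => u b) ⟨b, hb⟩ = 0 :=
        Finset.sum_eq_zero fun c _ => by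
          change _ * u c = 0
          rw [huS c c.2, mul_zero]
      rw [h2, Pi.zero_apply] at h1
      linarith
    rw [← huz]
    exact nonneg_of_mulVec_eq_off hM hv hMv hS (fun b hb => (huS b hb).ge) hoff a
  rw [IsoradialExists, ← mulVec_injective_iff_isUnit]
  refine (injective_iff_map_eq_zero (shiftedBlock M S).mulVecLin).mpr fun z hz => ?_
  rw [mulVecLin_apply] at hz
  refine funext fun a => le_antisymm ?_ (key z hz a)
  simpa using key (-z) (by rw [mulVec_neg, hz, neg_zero]) a

/-- If `u` satisfies the eigenvector equation for `ρ(M)` off `S`, then the isoradial reduction over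
`S` acts on the restriction of `u` as `M` acts on `u`. -/
theorem isoradialReduction_mulVec_apply {S : Finset ι} (hS : IsoradialExists M S) {u : ι → ℝ}
    (hu : ∀ a ∉ S, (M *ᵥ u) a = specRadius M * u a) (s : {a // a ∈ S}) :
    (isoradialReduction M S *ᵥ fun a => u a) s = (M *ᵥ u) s := by
  have h1 : (M.toBlock (· ∉ S) (· ∈ S) *ᵥ fun b => u b)
      = -(shiftedBlock M S *ᵥ fun b => u b) := by
    funext a
    rw [Pi.neg_apply, shiftedBlock_mulVec_apply, hu a a.2]
    ring
  have hdet : IsUnit (shiftedBlock M S).det := (isUnit_iff_isUnit_det _).mp hS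
  rw [isoradialReduction, sub_mulVec, ← mulVec_mulVec, ← mulVec_mulVec, h1, mulVec_neg,
    mulVec_mulVec _ (shiftedBlock M S)⁻¹, nonsing_inv_mul _ hdet, one_mulVec, mulVec_neg,
    sub_neg_eq_add, mulVec_apply_eq_add M S]
  rfl

/-- The unique extension of `x` to a vector that satisfies the eigenvector equation for `ρ(M)`
off `S`. -/
theorem exists_extension {S : Finset ι} (hS : IsoradialExists M S) (x : {a // a ∈ S} → ℝ) :
    ∃ u : ι → ℝ, (∀ a : {a // a ∈ S}, u a = x a) ∧
      ∀ a ∉ S, (M *ᵥ u) a = specRadius M * u a := by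
  set y := -((shiftedBlock M S)⁻¹ *ᵥ (M.toBlock (· ∉ S) (· ∈ S) *ᵥ x)) with hy
  set u : ι → ℝ := fun a => if h : a ∈ S then x ⟨a, h⟩ else y ⟨a, h⟩ with hu
  have hux : (fun b : {b // b ∈ S} => u b) = x := funext fun b => dif_pos b.2
  have huy : (fun b : {b // b ∉ S} => u b) = y := funext fun b => dif_neg b.2
  refine ⟨u, fun a => congrFun hux a, fun a ha => ?_⟩
  have hdet : IsUnit (shiftedBlock M S).det := (isUnit_iff_isUnit_det _).mp hS
  have h1 := shiftedBlock_mulVec_apply (M := M) S u ⟨a, ha⟩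
  rw [huy, hux, hy, mulVec_neg, mulVec_mulVec, mul_nonsing_inv _ hdet, one_mulVec,
    Pi.neg_apply] at h1
  linarith

/-- Each column of an isoradial reduction is the image under `M` of a nonnegative vector. -/
theorem exists_isoradialReduction_col (hM : M.IsIrreducible) {v : ι → ℝ} (hv : ∀ i, 0 < v i)
    (hMv : M *ᵥ v = specRadius M • v) {S : Finset ι} (t : {a // a ∈ S}) :
    ∃ u : ι → ℝ, (∀ a, 0 ≤ u a) ∧ u t = 1 ∧ (∀ a ∈ S, a ≠ t → u a = 0) ∧
      (∀ a ∉ S, (M *ᵥ u) a = specRadius M * u a) ∧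
      ∀ s, isoradialReduction M S s t = (M *ᵥ u) s := by
  have hne : S.Nonempty := ⟨t, t.2⟩
  have hS := isoradialExists hM hv hMv hne
  obtain ⟨u, hux, hoff⟩ := exists_extension hS (Pi.single t 1)
  refine ⟨u, nonneg_of_mulVec_eq_off hM hv hMv hne (fun a ha => ?_) hoff, ?_, fun a ha hat => ?_,
    hoff, fun s => ?_⟩
  · rw [hux ⟨a, ha⟩]
    have : (0 : {a // a ∈ S} → ℝ) ≤ Pi.single t 1 := Pi.single_nonneg.mpr zero_le_one
    exact this ⟨a, ha⟩
  · rw [hux t, Pi.single_eq_same]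
  · rw [hux ⟨a, ha⟩, Pi.single_eq_of_ne fun h => hat (congrArg Subtype.val h)]
  · rw [← isoradialReduction_mulVec_apply hS hoff, funext hux]
    simp

theorem isoradialReduction_nonneg (hM : M.IsIrreducible) {v : ι → ℝ} (hv : ∀ i, 0 < v i)
    (hMv : M *ᵥ v = specRadius M • v) {S : Finset ι} (s t : {a // a ∈ S}) :
    0 ≤ isoradialReduction M S s t := by
  obtain ⟨u, hu, -, -, -, h⟩ := exists_isoradialReduction_col hM hv hMv t
  rw [h]
  exact Finset.sum_nonneg fun a _ => mul_nonneg (hM.nonneg _ _) (hu a)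

/-- Otherwise `M u ≤ 0` at every zero of the extended column `u`: at `i` by assumption, off the pair
by the equation. Then `u` would be positive everywhere, although `u i = 0`. -/
theorem isoradialReduction_pair_pos (hM : M.IsIrreducible) {v : ι → ℝ} (hv : ∀ i, 0 < v i)
    (hMv : M *ᵥ v = specRadius M • v) {i j : ι} (hij : i ≠ j) :
    0 < isoradialReduction M {i, j} ⟨i, by simp⟩ ⟨j, by simp⟩ := by
  obtain ⟨u, hu, huj, hu0, hoff, h⟩ :=
    exists_isoradialReduction_col (S := {i, j}) hM hv hMv ⟨j, by simp⟩
  rw [h]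
  by_contra! hle
  have hui : u i = 0 := hu0 i (by simp) hij
  refine (hM.pos_of_mulVec_nonpos hu (s := j) (by simp [huj]) (fun a ha => ?_) i).ne' hui
  by_cases haS : a ∈ ({i, j} : Finset ι)
  · rcases Finset.mem_insert.mp haS with rfl | haj
    · exact hle
    · rw [Finset.mem_singleton.mp haj] at ha
      exact absurd (huj.symm.trans ha) one_ne_zero
  · rw [hoff a haS, ha, mul_zero]

theorem specRadius_transpose (M : Matrix ι ι ℝ) : specRadius Mᵀ = specRadius M := by
  have : spectrum ℂ (Mᵀ.map (algebraMap ℝ ℂ)) = spectrum ℂ (M.map (algebraMap ℝ ℂ)) := by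
    ext z
    rw [transpose_map, mem_spectrum_iff_isRoot_charpoly, mem_spectrum_iff_isRoot_charpoly,
      charpoly_transpose]
  simp only [specRadius, spectralRadius, this]

theorem isoradialReduction_transpose (M : Matrix ι ι ℝ) (S : Finset ι) :
    isoradialReduction Mᵀ S = (isoradialReduction M S)ᵀ := by
  have h : shiftedBlock Mᵀ S = (shiftedBlock M S)ᵀ := by
    rw [shiftedBlock, shiftedBlock, specRadius_transpose, transpose_sub, transpose_smul,
      transpose_one]
    rfl
  rw [isoradialReduction, isoradialReduction, h, transpose_sub, transpose_mul, transpose_mul,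
    transpose_nonsing_inv, Matrix.mul_assoc]
  rfl

theorem effectiveTransition_apply_of_ne (M : Matrix ι ι ℝ) {i j : ι} (hij : i ≠ j) :
    effectiveTransition M i j = isoradialReduction M {i, j} ⟨i, by simp⟩ ⟨j, by simp⟩ := by
  rw [effectiveTransition, of_apply, if_neg hij]

theorem effectiveTransition_apply_self (M : Matrix ι ι ℝ) (i : ι) :
    effectiveTransition M i i = ∑ k ∈ Finset.univ.erase i,
        isoradialReduction M {i, k} ⟨i, by simp⟩ ⟨i, by simp⟩ := by
  rw [effectiveTransition, of_apply, if_pos rfl]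

/-- Transfers the eigenvector computation to left eigenvectors, hence to stationary vectors. -/
theorem effectiveTransition_transpose (M : Matrix ι ι ℝ) :
    effectiveTransition Mᵀ = (effectiveTransition M)ᵀ := by
  ext i j
  rw [transpose_apply]
  rcases eq_or_ne i j with rfl | hij
  · simp only [effectiveTransition_apply_self, isoradialReduction_transpose, transpose_apply]
  · rw [effectiveTransition_apply_of_ne _ hij, effectiveTransition_apply_of_ne _ hij.symm,
      isoradialReduction_transpose, transpose_apply]
    -- `{i, j}` and `{j, i}` index different subtypes, so the equality of sets is generalized before
    -- substitution.
    have : ∀ S T : Finset ι, S = T → ∀ (hi : i ∈ S) (hj : j ∈ S) (hi' : i ∈ T) (hj' : j ∈ T),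
        isoradialReduction M S ⟨j, hj⟩ ⟨i, hi⟩ = isoradialReduction M T ⟨j, hj'⟩ ⟨i, hi'⟩ := by
      rintro S _ rfl _ _ _ _
      rfl
    exact this _ _ (Finset.pair_comm i j) _ _ _ _

theorem effectiveTransition_mulVec (hM : M.IsIrreducible) {v : ι → ℝ} (hv : ∀ i, 0 < v i)
    (hMv : M *ᵥ v = specRadius M • v) :
    effectiveTransition M *ᵥ v = (((Fintype.card ι : ℝ) - 1) * specRadius M) • v := by
  funext i
  -- Row `i` of the eigenvector equation for the reduction over `{i, k}`; summing over `k` produces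
  -- the factor `n - 1`.
  have hpair : ∀ k ∈ Finset.univ.erase i,
      isoradialReduction M {i, k} ⟨i, by simp⟩ ⟨i, by simp⟩ * v i
        + effectiveTransition M i k * v k = specRadius M * v i := by
    intro k hk
    have hik : i ≠ k := (Finset.ne_of_mem_erase hk).symm
    rw [effectiveTransition_apply_of_ne _ hik]
    have hS := isoradialExists hM hv hMv (S := {i, k}) ⟨i, by simp⟩
    have h := isoradialReduction_mulVec_apply hS (u := v) (fun a _ => congrFun hMv a) ⟨i, by simp⟩
    rw [hMv] at h
    rw [Pi.smul_apply, smul_eq_mul] at h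
    rw [← h, mulVec, dotProduct]
    have huniv : (Finset.univ : Finset {a // a ∈ ({i, k} : Finset ι)})
        = {⟨i, by simp⟩, ⟨k, by simp⟩} := by
      ext ⟨a, ha⟩
      simp only [Finset.mem_univ, true_iff, Finset.mem_insert, Finset.mem_singleton,
        Subtype.mk.injEq]
      simpa using ha
    rw [huniv, Finset.sum_pair fun h => hik (congrArg Subtype.val h)]
  rw [mulVec, dotProduct, ← Finset.add_sum_erase _ _ (Finset.mem_univ i),
    effectiveTransition_apply_self, Finset.sum_mul, ← Finset.sum_add_distrib,
    Finset.sum_congr rfl hpair, Finset.sum_const, Finset.card_erase_of_mem (Finset.mem_univ i),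
    Finset.card_univ, nsmul_eq_mul, Nat.cast_sub (Fintype.card_pos_iff.mpr ⟨i⟩), Nat.cast_one,
    Pi.smul_apply, smul_eq_mul, mul_assoc]

theorem effectiveTransition_pos_of_ne (hM : M.IsIrreducible) {i j : ι} (hij : i ≠ j) :
    0 < effectiveTransition M i j := by
  have : Nonempty ι := ⟨i⟩
  obtain ⟨v, hv⟩ := exists_isLeadingEigenvector hM
  rw [effectiveTransition_apply_of_ne M hij]
  exact isoradialReduction_pair_pos hM hv.1 hv.2.1 hij

theorem effectiveTransition_nonneg (hM : M.IsIrreducible) (i j : ι) :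
    0 ≤ effectiveTransition M i j := by
  have : Nonempty ι := ⟨i⟩
  obtain ⟨v, hv⟩ := exists_isLeadingEigenvector hM
  rcases eq_or_ne i j with rfl | hij
  · rw [effectiveTransition_apply_self]
    exact Finset.sum_nonneg fun k _ => isoradialReduction_nonneg hM hv.1 hv.2.1 _ _
  · exact (effectiveTransition_pos_of_ne hM hij).le

/-! ### Irreducibility and primitivity from positive off-diagonal entries; the case `n = 2`. -/

theorem isIrreducible_of_pos_of_ne [Nontrivial ι] {A : Matrix ι ι ℝ} (hA : ∀ i j, 0 ≤ A i j)
    (hpos : ∀ i j, i ≠ j → 0 < A i j) : A.IsIrreducible := by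
  refine (isIrreducible_iff_exists_pow_pos hA).mpr fun i j => ?_
  rcases eq_or_ne i j with rfl | hij
  · obtain ⟨k, hk⟩ := exists_ne i
    exact ⟨2, two_pos, by rw [sq]; exact mul_apply_pos_of_mid hA (hpos _ _ hk.symm) (hpos _ _ hk)⟩
  · exact ⟨1, one_pos, by rw [pow_one]; exact hpos i j hij⟩

theorem isPrimitive_of_pos_of_ne (hcard : 3 ≤ Fintype.card ι) {A : Matrix ι ι ℝ}
    (hA : ∀ i j, 0 ≤ A i j) (hpos : ∀ i j, i ≠ j → 0 < A i j) : A.IsPrimitive := by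
  refine ⟨hA, 2, two_pos, fun i j => ?_⟩
  -- A third index gives a path of length two from `i` to `j`, so the square is already positive.
  obtain ⟨k, hk⟩ : ∃ k, k ∉ ({i, j} : Finset ι) := by
    by_contra! h
    have := Finset.card_le_two (a := i) (b := j)
    rw [Finset.eq_univ_iff_forall.mpr h, Finset.card_univ] at this
    omega
  rw [Finset.mem_insert, Finset.mem_singleton, not_or] at hk
  rw [sq]
  exact mul_apply_pos_of_mid hA (hpos _ _ (Ne.symm hk.1)) (hpos _ _ hk.2)

theorem isoradialReduction_eq_of_eq_univ (M : Matrix ι ι ℝ) {S : Finset ι} (hS : S = Finset.univ)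
    (s t : {a // a ∈ S}) : isoradialReduction M S s t = M s t := by
  have : IsEmpty {a // a ∉ S} := ⟨fun a => a.2 (Finset.eq_univ_iff_forall.mp hS _)⟩
  rw [isoradialReduction, Matrix.sub_apply, mul_apply, Finset.univ_eq_empty, Finset.sum_empty,
    sub_zero, toBlock_apply]

theorem effectiveTransition_fin_two (M : Matrix (Fin 2) (Fin 2) ℝ) : effectiveTransition M = M := by
  have hu : ∀ i k : Fin 2, i ≠ k → ({i, k} : Finset (Fin 2)) = Finset.univ := by decide
  ext i j
  rcases eq_or_ne i j with rfl | hij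
  · have he : ∀ i : Fin 2, Finset.univ.erase i = {1 - i} := by decide
    have hne : ∀ i : Fin 2, i ≠ 1 - i := by decide
    rw [effectiveTransition_apply_self, he, Finset.sum_singleton,
      isoradialReduction_eq_of_eq_univ _ (hu _ _ (hne i))]
  · rw [effectiveTransition_apply_of_ne _ hij, isoradialReduction_eq_of_eq_univ _ (hu _ _ hij)]

end Reduction

end EffTrans

theorem proposition1 (n : ℕ) (hn : 2 ≤ n) (M : Matrix (Fin n) (Fin n) ℝ)
    (hM : M.IsIrreducible) :
    -- all isoradial reductions occurring in `E(M)` exist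
    (∀ i j : Fin n, i ≠ j → EffTrans.IsoradialExists M {i, j}) ∧
    -- (i)
    ((∀ i j : Fin n, 0 ≤ EffTrans.effectiveTransition M i j) ∧
      (EffTrans.effectiveTransition M).IsIrreducible) ∧
    -- (ii)
    (∃ v : Fin n → ℝ,
      (∀ w, EffTrans.IsLeadingEigenvector M w ↔ w = v) ∧
      (∀ w, EffTrans.IsLeadingEigenvector (EffTrans.effectiveTransition M) w ↔ w = v)) ∧
    -- (iii)
    EffTrans.specRadius (EffTrans.effectiveTransition M)
      = ((n : ℝ) - 1) * EffTrans.specRadius M ∧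
    -- (iv)
    (M ∈ Matrix.rowStochastic ℝ (Fin n) →
      EffTrans.scaledEffectiveTransition M ∈ Matrix.rowStochastic ℝ (Fin n) ∧
      (∃ p : Fin n → ℝ, (∀ i, 0 ≤ p i) ∧
        (∀ q, EffTrans.IsStationary M q ↔ q = p) ∧
        (∀ q, EffTrans.IsStationary (EffTrans.scaledEffectiveTransition M) q ↔ q = p)) ∧
      (3 ≤ n ∨ M.IsPrimitive → (EffTrans.scaledEffectiveTransition M).IsPrimitive)) := by
  open EffTrans Matrix in
  have : Nontrivial (Fin n) := Fin.nontrivial_iff_two_le.mpr hn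
  have hn' : (0 : ℝ) < (n : ℝ) - 1 := by
    have : (2 : ℝ) ≤ n := by exact_mod_cast hn
    linarith
  obtain ⟨v, hv⟩ := exists_isLeadingEigenvector hM
  have hE0 := effectiveTransition_nonneg hM
  have hEpos : ∀ i j, i ≠ j → 0 < effectiveTransition M i j :=
    fun i j => effectiveTransition_pos_of_ne hM
  have hE : (effectiveTransition M).IsIrreducible := isIrreducible_of_pos_of_ne hE0 hEpos
  have hEv := effectiveTransition_mulVec hM hv.1 hv.2.1
  rw [Fintype.card_fin] at hEv
  have hrad := specRadius_eq_of_mulVec_eq hE0 hv.1 hEv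
  refine ⟨fun i j _ => isoradialExists hM hv.1 hv.2.1 ⟨i, by simp⟩, ⟨hE0, hE⟩,
    ⟨v, isLeadingEigenvector_iff_eq hM hv,
      isLeadingEigenvector_iff_eq hE ⟨hv.1, by rw [hrad, hEv], hv.2.2⟩⟩, hrad, fun hMst => ?_⟩
  -- The all-ones vector is a positive eigenvector, which forces `ρ(M) = 1`.
  have hone : M *ᵥ 1 = (1 : ℝ) • (1 : Fin n → ℝ) := by rw [hMst.2, one_smul]
  have hρ : specRadius M = 1 := specRadius_eq_of_mulVec_eq hM.nonneg (fun _ => one_pos) hone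
  have hS0 : ∀ i j, 0 ≤ scaledEffectiveTransition M i j :=
    fun i j => mul_nonneg (inv_nonneg.mpr hn'.le) (hE0 i j)
  have hSpos : ∀ i j, i ≠ j → 0 < scaledEffectiveTransition M i j :=
    fun i j hij => mul_pos (inv_pos.mpr hn') (hEpos i j hij)
  have hS : (scaledEffectiveTransition M).IsIrreducible := isIrreducible_of_pos_of_ne hS0 hSpos
  refine ⟨⟨hS0, ?_⟩, ?_, ?_⟩
  · rw [scaledEffectiveTransition, smul_mulVec,
      effectiveTransition_mulVec hM (v := 1) (fun _ => one_pos) (by rw [hρ, hone]), Fintype.card_fin, hρ,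
      mul_one, smul_smul, inv_mul_cancel₀ hn'.ne', one_smul]
  · obtain ⟨p, hp⟩ := exists_isLeadingEigenvector hM.transpose
    have hMp : IsStationary M p := by
      refine ⟨?_, hp.2.2⟩
      rw [← mulVec_transpose, hp.2.1, specRadius_transpose, hρ, one_smul]
    have hSp : IsStationary (scaledEffectiveTransition M) p := by
      refine ⟨?_, hp.2.2⟩
      have h := effectiveTransition_mulVec hM.transpose hp.1 hp.2.1
      rw [effectiveTransition_transpose, mulVec_transpose, specRadius_transpose, hρ, mul_one,
        Fintype.card_fin] at h
      rw [scaledEffectiveTransition, vecMul_smul, h, smul_smul, inv_mul_cancel₀ hn'.ne', one_smul]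
    exact ⟨p, fun i => (hp.1 i).le, isStationary_iff_eq hM hp.1 hMp,
      isStationary_iff_eq hS hp.1 hSp⟩
  · intro h
    rcases hn.eq_or_lt with rfl | hn3
    · have hSM : scaledEffectiveTransition M = M := by
        rw [scaledEffectiveTransition, effectiveTransition_fin_two]
        norm_num
      rw [hSM]
      exact h.resolve_left (by norm_num)
    · exact isPrimitive_of_pos_of_ne (by rwa [Fintype.card_fin]) hS0 hSpos
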